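/- Let $F\subseteq L$ be a transcendental (i.e. not algebraic) field extension. Let $\mathrm{Zar}(L|F)$ be the set of all valuation rings $V$ with $F\subseteq V\subseteq L$ and quotient field $L$ (including $V=L$), endowed with the Zariski topology, i.e. the topology having as a subbasis of open sets the sets $\{V\in\mathrm{Zar}(L|F) : x_1,\dots,x_n\in V\}$, where $\{x_1,\dots,x_n\}$ ranges over the finite subsets of $L$. A topological space is called Noetherian if its open subsets satisfy the ascending chain condition. (a) If $\mathrm{trdeg}_F(L)=1$ and $L$ is finitely generated over $F$ as a field, then $\mathrm{Zar}(L|F)$ is a Noetherian space. (b) If $\mathrm{trdeg}_F(L)>1$ (possibly infinite, with no finite generation assumed), then $\mathrm{Zar}(L|F)$ is not a Noetherian space. -/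

import Mathlib

/-- The set `Over(K|D)` of rings lying between (the image of) `D` and `K`. -/
def OverringSpace (D K : Type*) [CommRing D] [Field K] [Algebra D K] : Type _ :=
  Subalgebra D K

namespace OverringSpace

variable {D K : Type*} [CommRing D] [Field K] [Algebra D K]

/-- The set `B(x₁, …, xₙ)` of the intermediate rings that contain `x₁, …, xₙ`. -/
def B (s : Finset K) : Set (OverringSpace D K) :=
  {T : Subalgebra D K | ∀ x ∈ s, x ∈ T}

/-- The Zariski topology: the sets `B(x₁, …, xₙ)` form a subbasis. -/
instance : TopologicalSpace (OverringSpace D K) :=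
  TopologicalSpace.generateFrom (Set.range (B : Finset K → Set (OverringSpace D K)))

end OverringSpace

/-- The Zariski space `Zar(K|D)` as a set: all valuation rings with quotient field `K`
that contain `D`. -/
def ZariskiSpace (D K : Type*) [CommRing D] [Field K] [Algebra D K] : Type _ :=
  {V : ValuationSubring K // ∀ d : D, algebraMap D K d ∈ V}

namespace ZariskiSpace

variable {D K : Type*} [CommRing D] [Field K] [Algebra D K]

/-- The inclusion `Zar(K|D) ⊆ Over(K|D)`. -/
def toOverringSpace (V : ZariskiSpace D K) : OverringSpace D K :=
  ({ V.1.toSubring with algebraMap_mem' := V.2 } : Subalgebra D K)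

/-- The Zariski topology on `Zar(K|D)` is the subspace topology from `Over(K|D)`. -/
instance : TopologicalSpace (ZariskiSpace D K) :=
  TopologicalSpace.induced toOverringSpace inferInstance

end ZariskiSpace

open Polynomial

/-! ### Valuation rings centred at a common element `y`. -/

namespace ValuationSubring

variable {F L : Type*} [Field F] [Field L]

/-! (a) Each `x` lies in all but finitely many `V`, so the Zariski topology is coarser than the
cofinite one, which is Noetherian. Indeed, for transcendental `x`, `x ∉ V` puts `y = x⁻¹` in the
maximal ideal of `V`; `exists_separating` and `eq_zero_of_sum_eq_zero` turn `n` such rings into `n`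
elements independent over `F[y]`, so `n ≤ [L : F(y)] < ∞`. (b) For independent `u, y` some `V n` has
`u ≡ 0` and `y uⁿ ≡ 1` modulo its maximal ideal. It contains `y uⁿ` but no `y uⁱ` with `i < n`, so
finite unions of the open sets `{V | y uⁱ ∈ V}` never stabilise. -/

theorem eval_mem (V : ValuationSubring L) {q : L[X]} (hq : ∀ i, q.coeff i ∈ V) {a : L}
    (ha : a ∈ V) : q.eval a ∈ V := by
  rw [eval_eq_sum_range]
  exact sum_mem fun i _ ↦ V.mul_mem _ _ (hq i) (pow_mem ha i)

/-- If `a` is a root of a polynomial that is primitive at `W`, then `a ∈ W` can be replaced by an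
element that is integral over the ring of coefficients. -/
theorem exists_notMem_nonunits_of_eval_eq_zero {q : L[X]} {a : L} (hqa : q.eval a = 0)
    {W : ValuationSubring L} (haW : a ∈ W) {k : ℕ} (hk : q.coeff k ∉ W.nonunits) :
    ∃ b ∉ W.nonunits, ∀ V : ValuationSubring L, (∀ i, q.coeff i ∈ V) →
      b ∈ V ∧ (a ∉ V → b ∈ V.nonunits) := by
  -- Horner tails of `q` at `a`, starting from `b 0 = q(a) = 0`. If `a ∉ V`, solving the recursion
  -- for `b (k + 1)` divides by `a` and stays in the maximal ideal.
  set b : ℕ → L := fun k ↦ (divX^[k] q).eval a with hb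
  have hcoeff (k i : ℕ) : (divX^[k] q).coeff i = q.coeff (i + k) := by
    induction k generalizing i with
    | zero => simp
    | succ k ih => rw [Function.iterate_succ_apply', coeff_divX, ih]; congr 1; ring
  have hstep (k : ℕ) : b k = b (k + 1) * a + q.coeff k := by
    conv_lhs => rw [hb]; dsimp only; rw [← divX_mul_X_add (divX^[k] q)]
    simp [hb, hcoeff, Function.iterate_succ_apply']
  have hmem (V : ValuationSubring L) (hV : ∀ i, q.coeff i ∈ V) (k : ℕ) :
      b k ∈ V ∧ (a ∉ V → b k ∈ V.nonunits) := by
    by_cases ha : a ∈ V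
    · exact ⟨V.eval_mem (fun i ↦ by rw [hcoeff]; exact hV _) ha, fun h ↦ (h ha).elim⟩
    · suffices h : b k ∈ V.nonunits from ⟨V.nonunits_subset h, fun _ ↦ h⟩
      have ha0 : a ≠ 0 := fun h ↦ ha (h ▸ V.zero_mem)
      induction k with
      | zero => simp [hb, hqa]
      | succ k ih =>
        have : b (k + 1) = a⁻¹ * (b k - q.coeff k) := by rw [hstep k]; field_simp; ring
        rw [this, mem_nonunits_iff, map_mul]
        have h1 : a⁻¹ ∈ V.nonunits := V.inv_mem_nonunits_iff.2 (.inr ha)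
        exact mul_lt_one_of_lt_of_le h1
          ((V.valuation_le_one_iff _).2 (sub_mem (V.nonunits_subset ih) (hV k)))
  by_contra! H
  have hall (j : ℕ) : b j ∈ W.nonunits := by
    by_contra hj
    obtain ⟨V, hV, h⟩ := H _ hj
    exact absurd (hmem V hV j) (by tauto)
  apply hk
  have : q.coeff k = b k - b (k + 1) * a := by rw [hstep k]; ring
  rw [this, mem_nonunits_iff]
  refine (W.valuation.map_sub _ _).trans_lt (max_lt (hall k) ?_)
  rw [map_mul]
  exact mul_lt_one_of_lt_of_le (hall _) ((W.valuation_le_one_iff _).2 haW)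

variable [Algebra F L]

theorem aeval_mem {V : ValuationSubring L} (hV : ∀ c : F, algebraMap F L c ∈ V) {y : L}
    (hy : y ∈ V) (p : F[X]) : aeval y p ∈ V := by
  rw [aeval_def, eval₂_eq_eval_map]
  exact V.eval_mem (fun i ↦ by rw [coeff_map]; exact hV _) hy

theorem algebraMap_mem_nonunits_iff {V : ValuationSubring L}
    (hV : ∀ c : F, algebraMap F L c ∈ V) {c : F} : algebraMap F L c ∈ V.nonunits ↔ c = 0 := by
  rw [mem_nonunits_iff_or, ← map_inv₀]
  simp only [hV, not_true_eq_false, or_false, map_eq_zero]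

theorem aeval_mem_nonunits_iff {V : ValuationSubring L} (hV : ∀ c : F, algebraMap F L c ∈ V)
    {y : L} (hy : y ∈ V.nonunits) {p : F[X]} : aeval y p ∈ V.nonunits ↔ X ∣ p := by
  have key : V.valuation (aeval y (divX p) * y) < 1 := by
    rw [map_mul, mul_comm]
    exact mul_lt_one_of_lt_of_le hy
      ((V.valuation_le_one_iff _).2 (aeval_mem hV (V.nonunits_subset hy) _))
  have hp : aeval y p = aeval y (divX p) * y + algebraMap F L (p.coeff 0) := by
    conv_lhs => rw [← divX_mul_X_add p]
    simp
  rw [X_dvd_iff, ← algebraMap_mem_nonunits_iff hV, hp, mem_nonunits_iff, mem_nonunits_iff]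
  refine ⟨fun h ↦ ?_, fun h ↦ (V.valuation.map_add _ _).trans_lt (max_lt key h)⟩
  rw [← add_sub_cancel_left (aeval y (divX p) * y) (algebraMap F L _)]
  exact (V.valuation.map_sub _ _).trans_lt (max_lt h key)

/-- `a` is a root of `p - p(a)`, monic after scaling, and `V` is integrally closed. -/
theorem mem_of_aeval_mem {V : ValuationSubring L} (hV : ∀ c : F, algebraMap F L c ∈ V)
    {p : F[X]} (hp : p.natDegree ≠ 0) {a : L} (ha : aeval a p ∈ V) : a ∈ V := by
  let _ : Algebra F V := ((algebraMap F L).codRestrict V.toSubring hV).toAlgebra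
  have hcomp : (algebraMap V L).comp (algebraMap F V) = algebraMap F L := rfl
  have hp0 : p ≠ 0 := fun h ↦ hp (by simp [h])
  set m := p * C p.leadingCoeff⁻¹ with hm
  have hmm : m.Monic := monic_mul_leadingCoeff_inv hp0
  have hmd : m.natDegree = p.natDegree := natDegree_mul_leadingCoeff_inv _ hp0
  have ht : aeval a m ∈ V := by
    rw [hm, map_mul, aeval_C]
    exact V.mul_mem _ _ ha (hV _)
  have hint : IsIntegral V a := by
    refine ⟨m.map (algebraMap F V) - C ⟨aeval a m, ht⟩, ?_, ?_⟩
    · refine (hmm.map _).sub_of_left (degree_C_le.trans_lt ?_)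
      rw [hmm.degree_map, ← natDegree_pos_iff_degree_pos, hmd]
      exact Nat.pos_of_ne_zero hp
    · rw [eval₂_sub, eval₂_map, hcomp, eval₂_C]
      exact sub_self _
  obtain ⟨z, rfl⟩ := IsIntegrallyClosed.isIntegral_iff.1 hint
  exact z.2

/-- Reducing `Q` modulo `y` gives a nonzero `p` over `F` with `p(a)` in the maximal ideal of `W`,
hence in `V`; so `a` is integral over `V`. -/
theorem eq_of_le_of_nonunits {V W : ValuationSubring L} (hV : ∀ c : F, algebraMap F L c ∈ V)
    (hVW : V ≤ W) {y : L} (hy : y ∈ W.nonunits)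
    (hprim : ∀ a : L, ∃ Q : F[X][X], Q.eval₂ (aeval y).toRingHom a = 0 ∧ ∃ k, ¬ X ∣ Q.coeff k) :
    V = W := by
  refine le_antisymm hVW fun a ha ↦ ?_
  have hW (c : F) : algebraMap F L c ∈ W := hVW (hV c)
  obtain ⟨Q, hQ, k, hk⟩ := hprim a
  set p : F[X] := Q.map constantCoeff with hp
  have hp0 : p ≠ 0 := fun h ↦ hk (by
    have := congr_arg (coeff · k) h
    simpa [hp, X_dvd_iff] using this)
  have hpa : aeval a p ∈ W.nonunits := by
    set T : L[X] := Q.map (aeval y).toRingHom - p.map (algebraMap F L) with hT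
    have h1 : aeval a p = - T.eval a := by
      rw [hT, eval_sub, eval_map, hQ, aeval_def, eval₂_eq_eval_map]; ring
    have h2 (i : ℕ) : T.coeff i ∈ W.nonunits := by
      have : T.coeff i = aeval y (Q.coeff i - C ((Q.coeff i).coeff 0)) := by
        simp [hT, hp]
      rw [this, aeval_mem_nonunits_iff hW hy, X_dvd_iff]
      simp
    rw [h1, mem_nonunits_iff, Valuation.map_neg, eval_eq_sum_range]
    refine W.valuation.map_sum_lt one_ne_zero fun i _ ↦ ?_
    rw [map_mul]
    exact mul_lt_one_of_lt_of_le (h2 i) ((W.valuation_le_one_iff _).2 (pow_mem ha i))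
  refine mem_of_aeval_mem hV (fun h ↦ ?_) (V.nonunits_subset (nonunits_le_nonunits.2 hVW hpa))
  obtain ⟨c, hc⟩ := natDegree_eq_zero.1 h
  rw [← hc, aeval_C, algebraMap_mem_nonunits_iff hW] at hpa
  exact hp0 (by rw [← hc, hpa, C_0])

/-- The valuation rings that contain `F` and have `y` in their maximal ideal are separated by
elements `e i`, which are then linearly independent over `F[y]`. -/
theorem exists_separating {ι : Type*} [Fintype ι] [DecidableEq ι] {V : ι → ValuationSubring L}
    (hinj : Function.Injective V) (hV : ∀ i, ∀ c : F, algebraMap F L c ∈ V i) {y : L}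
    (hy : ∀ i, y ∈ (V i).nonunits)
    (hprim : ∀ a : L, ∃ Q : F[X][X], Q.eval₂ (aeval y).toRingHom a = 0 ∧ ∃ k, ¬ X ∣ Q.coeff k) :
    ∃ e : ι → L, ∀ i, e i ∉ (V i).nonunits ∧ ∀ j, e i ∈ V j ∧ (i ≠ j → e i ∈ (V j).nonunits) := by
  have pair (i j : ι) : ∃ b ∉ (V i).nonunits, ∀ l, b ∈ V l ∧ (i ≠ j → l = j → b ∈ (V l).nonunits) := by
    by_cases hij : i = j
    · exact ⟨1, by simp [mem_nonunits_iff], fun l ↦ ⟨one_mem _, fun h ↦ (h hij).elim⟩⟩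
    obtain ⟨a, hai, haj⟩ : ∃ a ∈ V i, a ∉ V j := by
      by_contra! h
      exact hij (hinj (eq_of_le_of_nonunits (hV i) h (hy j) hprim))
    obtain ⟨Q, hQ, k, hk⟩ := hprim a
    have hco (l : ι) (n : ℕ) : (Q.map (aeval y).toRingHom).coeff n ∈ V l := by
      rw [coeff_map]
      exact aeval_mem (hV l) ((V l).nonunits_subset (hy l)) _
    obtain ⟨b, hb, h⟩ := exists_notMem_nonunits_of_eval_eq_zero (q := Q.map (aeval y).toRingHom)
      (by rwa [eval_map]) hai (k := k)
      (by rw [coeff_map]; exact fun h ↦ hk ((aeval_mem_nonunits_iff (hV i) (hy i)).1 h))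
    exact ⟨b, hb, fun l ↦ ⟨(h _ (hco l)).1, fun _ hl ↦ (h _ (hco l)).2 (hl ▸ haj)⟩⟩
  choose b hb hbl using pair
  refine ⟨fun i ↦ ∏ j, b i j, fun i ↦ ⟨?_, fun j ↦ ⟨prod_mem fun l _ ↦ (hbl i l j).1, fun hij ↦ ?_⟩⟩⟩
  · have (j : ι) : (V i).valuation (b i j) = 1 :=
      le_antisymm (((V i).valuation_le_one_iff _).2 (hbl i j i).1) (not_lt.1 (hb i j))
    simp [mem_nonunits_iff, this]
  · dsimp only
    rw [← Finset.mul_prod_erase _ _ (Finset.mem_univ j), mem_nonunits_iff, map_mul]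
    exact mul_lt_one_of_lt_of_le ((hbl i j j).2 hij rfl)
      (((V j).valuation_le_one_iff _).2 (prod_mem fun l _ ↦ (hbl i l j).1))

/-- Reducing a relation at each `V i` shows that `X` divides every `p i`. Cancelling `y` and
repeating makes `p i` divisible by all powers of `X`. -/
theorem eq_zero_of_sum_eq_zero {ι : Type*} [Fintype ι] {V : ι → ValuationSubring L}
    (hV : ∀ i, ∀ c : F, algebraMap F L c ∈ V i) {y : L} (hy0 : y ≠ 0)
    (hy : ∀ i, y ∈ (V i).nonunits) {e : ι → L}
    (he : ∀ i, e i ∉ (V i).nonunits ∧ ∀ j, e i ∈ V j ∧ (i ≠ j → e i ∈ (V j).nonunits))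
    {p : ι → F[X]} (hp : ∑ i, aeval y (p i) * e i = 0) (i : ι) : p i = 0 := by
  classical
  have hdvd (q : ι → F[X]) (hq : ∑ i, aeval y (q i) * e i = 0) (i : ι) : X ∣ q i := by
    rw [← aeval_mem_nonunits_iff (hV i) (hy i), mem_nonunits_iff]
    have h1 : (V i).valuation (aeval y (q i) * e i) < 1 := by
      rw [← Finset.add_sum_erase _ _ (Finset.mem_univ i), add_eq_zero_iff_eq_neg] at hq
      rw [hq, Valuation.map_neg]
      refine Valuation.map_sum_lt _ one_ne_zero fun j hj ↦ ?_
      rw [map_mul, mul_comm]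
      exact mul_lt_one_of_lt_of_le (((he j).2 i).2 (Finset.ne_of_mem_erase hj))
        (((V i).valuation_le_one_iff _).2 (aeval_mem (hV i) ((V i).nonunits_subset (hy i)) _))
    have h2 : (V i).valuation (e i) = 1 :=
      le_antisymm (((V i).valuation_le_one_iff _).2 ((he i).2 i).1) (not_lt.1 (he i).1)
    rwa [map_mul, h2, mul_one] at h1
  have hpow (n : ℕ) : ∃ q : ι → F[X], (∀ i, p i = X ^ n * q i) ∧
      ∑ i, aeval y (q i) * e i = 0 := by
    induction n with
    | zero => exact ⟨p, by simp, hp⟩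
    | succ n ih =>
      obtain ⟨q, hpq, hq⟩ := ih
      choose r hr using hdvd q hq
      refine ⟨r, fun i ↦ by rw [hpq, hr, pow_succ, mul_assoc], ?_⟩
      have : y * ∑ i, aeval y (r i) * e i = 0 := by
        rw [← hq, Finset.mul_sum]
        exact Finset.sum_congr rfl fun i _ ↦ by rw [hr i, map_mul, aeval_X, mul_assoc]
      exact (mul_eq_zero.1 this).resolve_left hy0
  obtain ⟨q, hq, -⟩ := hpow ((p i).natDegree + 1)
  by_contra h
  have := natDegree_le_of_dvd ⟨q i, hq i⟩ h
  simp at this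

end ValuationSubring

/-- Dividing a relation by the largest power of `X` keeps the root, since `y ≠ 0`. -/
theorem exists_eval₂_eq_zero_and_not_X_dvd {F L : Type*} [Field F] [Field L] [Algebra F L]
    {y : L} (hy : y ≠ 0) {a : L} (ha : IsAlgebraic (Algebra.adjoin F {y}) a) :
    ∃ Q : F[X][X], Q.eval₂ (aeval y).toRingHom a = 0 ∧ ∃ k, ¬ X ∣ Q.coeff k := by
  obtain ⟨q, hq0, hq⟩ := ha
  let φ : F[X] →ₐ[F] Algebra.adjoin F {y} :=
    aeval ⟨y, Algebra.subset_adjoin (Set.mem_singleton y)⟩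
  have hφval (p : F[X]) : (φ p : L) = aeval y p :=
    (aeval_algHom_apply (Algebra.adjoin F {y}).val _ p).symm
  have hφ : Function.Surjective φ.toRingHom := fun ⟨z, hz⟩ ↦ by
    obtain ⟨p, rfl⟩ : z ∈ (aeval (R := F) y).range := by
      rwa [← Algebra.adjoin_singleton_eq_range_aeval]
    exact ⟨p, Subtype.ext (hφval p)⟩
  obtain ⟨P, rfl⟩ := map_surjective _ hφ q
  have hP0 : P ≠ 0 := fun h ↦ hq0 (by simp [h])
  have hP : P.eval₂ (aeval y).toRingHom a = 0 := by
    rw [← hq, aeval_def, eval₂_map]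
    congr 1
    exact RingHom.ext fun p ↦ (hφval p).symm
  have hfin : FiniteMultiplicity (C (X : F[X])) P :=
    .of_prime_left (prime_C_iff.2 prime_X) hP0
  obtain ⟨Q, hPQ, hQ⟩ := hfin.exists_eq_pow_mul_and_not_dvd
  refine ⟨Q, ?_, by simpa [C_dvd_iff_dvd_coeff] using hQ⟩
  rw [hPQ, eval₂_mul, eval₂_pow, eval₂_C] at hP
  refine (mul_eq_zero.1 hP).resolve_left (pow_ne_zero _ ?_)
  simpa using hy

/-! ### Finiteness in transcendence degree one. -/

section FunctionField

variable {F L : Type*} [Field F] [Field L] [Algebra F L]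

open scoped IntermediateField.algebraAdjoinAdjoin in
theorem finite_setOf_mem_nonunits {y : L} (hy : y ≠ 0)
    [FiniteDimensional (IntermediateField.adjoin F {y}) L] :
    {V : ValuationSubring L | (∀ c : F, algebraMap F L c ∈ V) ∧ y ∈ V.nonunits}.Finite := by
  classical
  have : Algebra.IsAlgebraic (Algebra.adjoin F {y}) L :=
    (IsFractionRing.comap_isAlgebraic_iff (K := IntermediateField.adjoin F {y})).2 inferInstance
  by_contra hinf
  obtain ⟨t, ht, hcard⟩ := Set.Infinite.exists_subset_card_eq hinf
    (Module.finrank (IntermediateField.adjoin F {y}) L + 1)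
  have hV (i : t) := (ht i.2).1
  have hyV (i : t) := (ht i.2).2
  obtain ⟨e, he⟩ := ValuationSubring.exists_separating Subtype.val_injective hV hyV
    fun a ↦ exists_eval₂_eq_zero_and_not_X_dvd hy (Algebra.IsAlgebraic.isAlgebraic a)
  have hli : LinearIndependent (Algebra.adjoin F {y}) e := by
    rw [Fintype.linearIndependent_iff]
    intro g hg i
    have (i : t) : ∃ p : F[X], aeval y p = (g i : L) := by
      simp [← AlgHom.mem_range, ← Algebra.adjoin_singleton_eq_range_aeval]
    choose p hp using this
    have := ValuationSubring.eq_zero_of_sum_eq_zero hV hy hyV he (p := p)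
      (by simpa only [hp, Algebra.smul_def] using! hg) i
    exact Subtype.ext (by rw [← hp, this, map_zero]; rfl)
  -- Clearing denominators passes from `F[y]` to its fraction field `F(y)`.
  rw [LinearIndependent.iff_fractionRing _ (IntermediateField.adjoin F {y})] at hli
  have := hli.fintype_card_le_finrank
  rw [Fintype.card_coe, hcard] at this
  omega

theorem finiteDimensional_adjoin_singleton_of_trdeg_eq_one (h1 : Algebra.trdeg F L = 1)
    (hfg : (⊤ : IntermediateField F L).FG) {y : L} (hy : Transcendental F y) :
    FiniteDimensional (IntermediateField.adjoin F {y}) L := by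
  have hai : AlgebraicIndependent F fun _ : Unit ↦ y := by
    rwa [algebraicIndependent_unique_type_iff]
  have hb := hai.isTranscendenceBasis_of_lift_trdeg_le_of_finite (by simp [h1])
  have halg := hb.isAlgebraic_field
  rw [Set.range_const] at halg
  have : Algebra.EssFiniteType F L := IntermediateField.fg_top_iff.1 hfg
  have : Algebra.EssFiniteType (IntermediateField.adjoin F {y}) L := .of_comp F _ _
  exact Algebra.finite_of_essFiniteType_of_isAlgebraic

namespace ZariskiSpace

theorem isOpen_setOf_mem (x : L) : IsOpen {V : ZariskiSpace F L | x ∈ V.1} :=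
  ⟨_, TopologicalSpace.isOpen_generateFrom_of_mem ⟨{x}, rfl⟩, by
    ext V
    change (∀ z ∈ ({x} : Finset L), z ∈ V.1) ↔ x ∈ V.1
    simp⟩

theorem finite_setOf_notMem (h1 : Algebra.trdeg F L = 1)
    (hfg : (⊤ : IntermediateField F L).FG) (x : L) :
    {V : ZariskiSpace F L | x ∉ V.1}.Finite := by
  by_cases hx : Transcendental F x
  · have hx0 : x⁻¹ ≠ 0 := inv_ne_zero fun h ↦ hx (h ▸ isAlgebraic_zero)
    have hx' : Transcendental F x⁻¹ := fun h ↦ hx (by simpa using h.inv)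
    have := finiteDimensional_adjoin_singleton_of_trdeg_eq_one h1 hfg hx'
    refine Set.Finite.of_finite_image ((finite_setOf_mem_nonunits (F := F) hx0).subset ?_)
      Subtype.val_injective.injOn
    rintro _ ⟨V, hV, rfl⟩
    exact ⟨V.2, V.1.inv_mem_nonunits_iff.2 (.inr hV)⟩
  · convert Set.finite_empty
    refine Set.eq_empty_of_forall_notMem fun V hV ↦ hV ?_
    obtain ⟨p, hp0, hp⟩ : IsAlgebraic F x := not_not.1 hx
    refine ValuationSubring.mem_of_aeval_mem V.2 (p := p) (fun h ↦ ?_) (hp ▸ V.1.zero_mem)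
    obtain ⟨c, rfl⟩ := natDegree_eq_zero.1 h
    rw [aeval_C, map_eq_zero] at hp
    exact hp0 (by rw [hp, C_0])

theorem noetherianSpace_of_trdeg_eq_one (h1 : Algebra.trdeg F L = 1)
    (hfg : (⊤ : IntermediateField F L).FG) :
    TopologicalSpace.NoetherianSpace (ZariskiSpace F L) := by
  refine TopologicalSpace.noetherianSpace_of_surjective
    (CofiniteTopology.of (X := ZariskiSpace F L)).symm ?_ (Equiv.surjective _)
  refine continuous_induced_rng.2 (continuous_generateFrom_iff.2 ?_)
  rintro _ ⟨s, rfl⟩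
  refine CofiniteTopology.isOpen_iff.2 fun _ ↦ ?_
  have h : {V : ZariskiSpace F L | ¬ ∀ x ∈ s, x ∈ V.1}.Finite := by
    refine (s.finite_toSet.biUnion fun x _ ↦ finite_setOf_notMem h1 hfg x).subset fun V hV ↦ ?_
    simpa using hV
  exact h.preimage (Equiv.injective CofiniteTopology.of.symm).injOn

/-! ### Failure in higher transcendence degree. -/

theorem exists_mem_nonunits {ι : Type*} {z : ι → L} (hz : AlgebraicIndependent F z) (c : ι → F) :
    ∃ V : ZariskiSpace F L, ∀ i, z i - algebraMap F L (c i) ∈ V.1.nonunits := by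
  -- The `F`-point `z ↦ c`; its kernel is proper, so it lies in the maximal ideal of some valuation
  -- ring of `L`.
  let ψ : Algebra.adjoin F (Set.range z) →ₐ[F] F :=
    (MvPolynomial.aeval c).comp hz.aevalEquiv.symm.toAlgHom
  obtain ⟨V, hAV, hV⟩ := Ideal.image_subset_nonunits_valuationSubring
    (A := (Algebra.adjoin F (Set.range z)).toSubring) (RingHom.ker ψ.toRingHom)
    (RingHom.ker_ne_top _)
  refine ⟨⟨V, fun d ↦ hAV (Subalgebra.algebraMap_mem _ d)⟩, fun i ↦ ?_⟩
  have key : hz.aevalEquiv (MvPolynomial.X i - MvPolynomial.C (c i)) ∈ RingHom.ker ψ.toRingHom := by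
    rw [RingHom.mem_ker]
    change MvPolynomial.aeval c (hz.aevalEquiv.symm (hz.aevalEquiv _)) = 0
    rw [AlgEquiv.symm_apply_apply]
    simp
  refine hV ⟨_, key, ?_⟩
  change ((hz.aevalEquiv _ : Algebra.adjoin F (Set.range z)) : L) = _
  rw [AlgebraicIndependent.aevalEquiv_apply_coe]
  simp

theorem not_noetherianSpace_of_algebraicIndependent {u y : L}
    (hu : AlgebraicIndependent F fun _ : Unit ↦ u)
    (hy : Transcendental (Algebra.adjoin F (Set.range fun _ : Unit ↦ u)) y) :
    ¬ TopologicalSpace.NoetherianSpace (ZariskiSpace F L) := by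
  intro hN
  have hu0 : u ≠ 0 := hu.ne_zero ()
  have hV (n : ℕ) : ∃ V : ZariskiSpace F L, u ∈ V.1.nonunits ∧ y * u ^ n - 1 ∈ V.1.nonunits := by
    have hw : Transcendental (Algebra.adjoin F (Set.range fun _ : Unit ↦ u)) (y * u ^ n) := by
      intro h
      have hun : u ^ n ∈ Algebra.adjoin F (Set.range fun _ : Unit ↦ u) :=
        pow_mem (Algebra.subset_adjoin (Set.mem_range_self ())) n
      have := IsAlgebraic.mul h (isAlgebraic_algebraMap
        (⟨u ^ n, hun⟩ : Algebra.adjoin F (Set.range fun _ : Unit ↦ u))).inv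
      change IsAlgebraic _ (y * u ^ n * (u ^ n)⁻¹) at this
      rw [mul_inv_cancel_right₀ (pow_ne_zero n hu0)] at this
      exact hy this
    obtain ⟨V, hV⟩ := exists_mem_nonunits ((hu.option_iff_transcendental _).2 hw)
      (fun o ↦ o.elim 1 fun _ ↦ 0)
    exact ⟨V, by simpa using hV (some ()), by simpa using hV none⟩
  let U : ℕ →o TopologicalSpace.Opens (ZariskiSpace F L) :=
    { toFun n := ⟨⋃ i < n, {V | y * u ^ i ∈ V.1},
        isOpen_biUnion fun i _ ↦ isOpen_setOf_mem _⟩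
      monotone' := fun m n hmn ↦
        Set.biUnion_subset_biUnion_left fun i (hi : i < m) ↦ hi.trans_le hmn }
  obtain ⟨n, hn⟩ := WellFoundedGT.monotone_chain_condition U
  obtain ⟨V, huV, hwV⟩ := hV n
  have hw : V.1.valuation (y * u ^ n) = 1 := by
    have := V.1.valuation.map_add_eq_of_lt_right (x := y * u ^ n - 1) (y := 1)
      (by rw [Valuation.map_one]; exact hwV)
    rwa [sub_add_cancel, Valuation.map_one] at this
  have hmem : V ∈ U (n + 1) :=
    Set.mem_biUnion (Nat.lt_succ_self n) ((V.1.valuation_le_one_iff _).1 hw.le)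
  rw [← hn (n + 1) n.le_succ] at hmem
  obtain ⟨i, hi, hiV⟩ := Set.mem_iUnion₂.1 hmem
  -- `y uⁿ = (y uⁱ) uⁿ⁻ⁱ` would have value below 1, as `i < n`.
  refine hw.not_lt ?_
  rw [← Nat.add_sub_cancel' hi.le, pow_add, ← mul_assoc, map_mul, mul_comm, map_pow]
  exact mul_lt_one_of_lt_of_le (pow_lt_one' huV (Nat.sub_ne_zero_of_lt hi))
    ((V.1.valuation_le_one_iff _).2 hiV)

theorem not_noetherianSpace_of_one_lt_trdeg (h : 1 < Algebra.trdeg F L) :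
    ¬ TopologicalSpace.NoetherianSpace (ZariskiSpace F L) := by
  obtain ⟨s, hs⟩ := exists_isTranscendenceBasis F L
  rw [← hs.cardinalMk_eq_trdeg, Cardinal.one_lt_iff_nontrivial] at h
  obtain ⟨a, b, hab⟩ := exists_pair_ne s
  have hinj : Function.Injective fun o : Option Unit ↦ o.elim b fun _ ↦ a := by
    rintro (_ | _) (_ | _) h <;> simp_all [eq_comm]
  have := hs.1.comp _ hinj
  have h2 : AlgebraicIndependent F fun o : Option Unit ↦ o.elim (b : L) fun _ ↦ (a : L) := by
    convert this using 1
    ext (_ | _) <;> rfl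
  obtain ⟨h3, h4⟩ := AlgebraicIndependent.option_iff.1 h2
  exact not_noetherianSpace_of_algebraicIndependent h3 h4

end ZariskiSpace

end FunctionField

theorem mainTheorem7 {F L : Type*} [Field F] [Field L] [Algebra F L]
    (hFL : Algebra.Transcendental F L) :
    (Algebra.trdeg F L = 1 → (⊤ : IntermediateField F L).FG →
      TopologicalSpace.NoetherianSpace (ZariskiSpace F L)) ∧
    (1 < Algebra.trdeg F L →
      ¬ TopologicalSpace.NoetherianSpace (ZariskiSpace F L)) :=
  ⟨ZariskiSpace.noetherianSpace_of_trdeg_eq_one, ZariskiSpace.not_noetherianSpace_of_one_lt_trdeg⟩
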